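/- Let $f:\mathbb{R}\times\mathbb{R}^n\times\mathbb{R}^m\to\mathbb{R}^n$ and $g:\mathbb{R}\times\mathbb{R}^m\to\mathbb{R}^m$ be continuous in $t$ and locally Lipschitz in the state, uniformly in $t$: for every compact set $K\subset\mathbb{R}^n\times\mathbb{R}^m$ there is $L\ge 0$ with $|f(t,x,z)-f(t,x',z')|\le L\,|(x,z)-(x',z')|$ for all $t\in\mathbb{R}$ and $(x,z),(x',z')\in K$, and likewise for $g$ on compact subsets of $\mathbb{R}^m$. Here $|\cdot|$ is the Euclidean norm. For a system $\dot\xi=F(t,\xi)$ on $\mathbb{R}^N$, a solution with initial condition $(t_\circ,\xi_\circ)\in\mathbb{R}\times\mathbb{R}^N$ is a function $\xi(\cdot)$ on an interval $[t_\circ,b)$, $t_\circ<b\le\infty$, with $\xi(t_\circ)=\xi_\circ$ that satisfies the equation there. The origin is called uniformly globally asymptotically stable (UGAS) if every initial condition $(t_\circ,\xi_\circ)$ admits a solution on $[t_\circ,\infty)$ and 1. (uniform global stability) there is a continuous, strictly increasing, unbounded function $\gamma:[0,\infty)\to[0,\infty)$ with $\gamma(0)=0$ such that, for all $(t_\circ,\xi_\circ)$,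 every solution satisfies $|\xi(t)|\le\gamma(|\xi_\circ|)$ for all $t\ge t_\circ$ in its domain; 2. (uniform global attractivity) for all $r,\sigma>0$ there is $T>0$ such that, for all $t_\circ$ and all $|\xi_\circ|\le r$, every solution satisfies $|\xi(t)|\le\sigma$ for all $t\ge t_\circ+T$ in its domain. Consider the cascade $$\dot x=f(t,x,z),\qquad \dot z=g(t,z).$$ Suppose that each initial state produces trajectories of the cascade that are bounded uniformly in the initial time: for each $(x_\circ,z_\circ)$ there is $M>0$ such that, for every $t_\circ\in\mathbb{R}$, every solution of the cascade with initial condition $(t_\circ,(x_\circ,z_\circ))$ satisfies $|(x(t),z(t))|\le M$ for all $t\ge t_\circ$ in its domain. Suppose further that the origins of $\dot z=g(t,z)$ and of $\dot x=f(t,x,0)$ are UGAS. Then the origin of the cascade is UGAS. -/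

import Mathlib

open Set Filter Topology

section TimeVaryingSystems

/-- `γ`, restricted to `[0, ∞)`, is a function of class `K∞`: continuous, strictly increasing,
zero at zero and unbounded. -/
structure IsClassKInf (γ : ℝ → ℝ) : Prop where
  continuousOn : ContinuousOn γ (Ici 0)
  strictMonoOn : StrictMonoOn γ (Ici 0)
  map_zero : γ 0 = 0
  tendsto_atTop : Tendsto γ atTop atTop

/-- A function of time and state is locally Lipschitz in the state, uniformly in time: on each
compact set of states there is a Lipschitz constant valid for all times. -/
def LocallyLipschitzUniformlyInTime {E G : Type*} [PseudoEMetricSpace E] [PseudoEMetricSpace G]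
    (F : ℝ → E → G) : Prop :=
  ∀ K : Set E, IsCompact K → ∃ L : NNReal, ∀ t : ℝ, LipschitzOnWith L (F t) K

variable {E : Type*} [NormedAddCommGroup E] [NormedSpace ℝ E]

/-- `x` is a solution on `[t₀, b)` of the differential equation `ẋ = F(t, x)` with `x(t₀) = x₀`
(`b = ⊤` is allowed). The derivative at `t₀` is one-sided; the values of `x` outside `[t₀, b)` play
no role. -/
structure IsSolution (F : ℝ → E → E) (t₀ : ℝ) (x₀ : E) (b : EReal) (x : ℝ → E) : Prop where
  initial : x t₀ = x₀
  deriv : ∀ t : ℝ, t₀ ≤ t → (t : EReal) < b → HasDerivWithinAt x (F t (x t)) (Ici t₀) t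

/-- Every initial condition `(t₀, x₀)` admits a solution on `[t₀, ∞)`. -/
def IsForwardComplete (F : ℝ → E → E) : Prop :=
  ∀ (t₀ : ℝ) (x₀ : E), ∃ x : ℝ → E, IsSolution F t₀ x₀ ⊤ x

/-- Uniform global stability of the origin. -/
def IsUGS (F : ℝ → E → E) : Prop :=
  IsForwardComplete F ∧
    ∃ γ : ℝ → ℝ, IsClassKInf γ ∧
      ∀ (t₀ : ℝ) (x₀ : E) (b : EReal) (x : ℝ → E), IsSolution F t₀ x₀ b x →
        ∀ t : ℝ, t₀ ≤ t → (t : EReal) < b → ‖x t‖ ≤ γ ‖x₀‖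

/-- Uniform global attractivity of the origin. -/
def IsUGA (F : ℝ → E → E) : Prop :=
  IsForwardComplete F ∧
    ∀ r σ : ℝ, 0 < r → 0 < σ → ∃ T : ℝ, 0 < T ∧
      ∀ (t₀ : ℝ) (x₀ : E) (b : EReal) (x : ℝ → E), IsSolution F t₀ x₀ b x → ‖x₀‖ ≤ r →
        ∀ t : ℝ, t₀ + T ≤ t → (t : EReal) < b → ‖x t‖ ≤ σ

/-- Uniform global asymptotic stability of the origin. -/
def IsUGAS (F : ℝ → E → E) : Prop :=
  IsUGS F ∧ IsUGA F

/-- Each initial state produces trajectories that are bounded uniformly in the initial time. The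
bound may depend on the initial state in an arbitrary way, and solutions are not assumed to
exist for all times. -/
def BoundedUniformlyInInitialTime (F : ℝ → E → E) : Prop :=
  ∀ x₀ : E, ∃ M : ℝ, 0 < M ∧
    ∀ (t₀ : ℝ) (b : EReal) (x : ℝ → E), IsSolution F t₀ x₀ b x →
      ∀ t : ℝ, t₀ ≤ t → (t : EReal) < b → ‖x t‖ ≤ M

end TimeVaryingSystems

/-- The right-hand side of the cascade `ẋ = f(t, x, z)`, `ż = g(t, z)`, on the product of the two
state spaces with its Euclidean norm. -/
def cascade {n m : ℕ}
    (f : ℝ → EuclideanSpace ℝ (Fin n) → EuclideanSpace ℝ (Fin m) → EuclideanSpace ℝ (Fin n))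
    (g : ℝ → EuclideanSpace ℝ (Fin m) → EuclideanSpace ℝ (Fin m)) :
    ℝ → WithLp 2 (EuclideanSpace ℝ (Fin n) × EuclideanSpace ℝ (Fin m)) →
      WithLp 2 (EuclideanSpace ℝ (Fin n) × EuclideanSpace ℝ (Fin m)) :=
  fun t w => WithLp.toLp 2 (f t w.fst w.snd, g t w.snd)

/-! The assumed bound depends on the initial state in an arbitrary way; the point is to make it
uniform on balls. By compactness it suffices to work near one state `v₀`
(`exists_nhds_bound_cascade`). Uniform attractivity of the `z`-system gives a time `T`, independent
of `t₀`, after which `z` is small. Up to time `T`, Grönwall keeps nearby trajectories close to the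
bounded one from `v₀`. After `T`, `x` is driven by a small input.

Small inputs are handled in windows of fixed length: on each, `x` stays close to the undriven
trajectory from the same state, which is small at the end of the window. The driven state thus
returns to the initial ball and the argument repeats (`exists_forall_norm_le_of_small_input`). The
same lemma, started at small states, gives local stability of the cascade.

Bounds on balls and local stability combine into a class `K∞` estimate. For attractivity, wait until
`z` is small, then one window until `x` is small; local stability does the rest. -/

/-! ### Truncation to a ball. -/

/-- The radial retraction onto the closed ball of radius `R`. -/
noncomputable def radialRetraction {E : Type*} [NormedAddCommGroup E] [NormedSpace ℝ E]
    (R : ℝ) (x : E) : E :=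
  (R / max R ‖x‖) • x

section RadialRetraction

variable {E : Type*} [NormedAddCommGroup E] [NormedSpace ℝ E]

lemma radialRetraction_of_norm_le {R : ℝ} (hR : 0 < R) {x : E} (hx : ‖x‖ ≤ R) :
    radialRetraction R x = x := by
  simp [radialRetraction, max_eq_left hx, hR.ne']

lemma radialRetraction_mem {R : ℝ} (hR : 0 < R) (x : E) :
    radialRetraction R x ∈ Metric.closedBall (0 : E) R := by
  have hpos : 0 < max R ‖x‖ := lt_max_of_lt_left hR
  rw [mem_closedBall_zero_iff, radialRetraction, norm_smul, Real.norm_of_nonneg (by positivity),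
    div_mul_eq_mul_div, div_le_iff₀ hpos]
  exact mul_le_mul_of_nonneg_left (le_max_right _ _) hR.le

/-- The constant 2 is not sharp in Euclidean space, but it needs only the triangle inequality:
moving the vector and changing the scaling factor each cost at most `‖x - y‖`. -/
lemma lipschitzWith_radialRetraction {R : ℝ} (hR : 0 < R) :
    LipschitzWith 2 (radialRetraction R : E → E) := by
  refine LipschitzWith.of_dist_le_mul fun x y => ?_
  rw [dist_eq_norm, dist_eq_norm]
  set a := max R ‖x‖ with ha
  set b := max R ‖y‖ with hb
  have hapos : 0 < a := lt_max_of_lt_left hR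
  have hbpos : 0 < b := lt_max_of_lt_left hR
  have hRa : R ≤ a := le_max_left _ _
  have hyb : ‖y‖ ≤ b := le_max_right _ _
  have hab : |b - a| ≤ ‖x - y‖ := by
    rw [ha, hb]
    refine (abs_max_sub_max_le_max R ‖y‖ R ‖x‖).trans ?_
    simp only [sub_self, abs_zero]
    rw [max_eq_right (abs_nonneg _), norm_sub_rev]
    exact abs_norm_sub_norm_le y x
  have hsplit : radialRetraction R x - radialRetraction R y
      = (R / a) • (x - y) + (R / a - R / b) • y := by
    simp only [radialRetraction, ← ha, ← hb, smul_sub, sub_smul]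
    abel
  have h1 : ‖(R / a) • (x - y)‖ ≤ ‖x - y‖ := by
    rw [norm_smul, Real.norm_of_nonneg (by positivity)]
    exact mul_le_of_le_one_left (norm_nonneg _) ((div_le_one hapos).2 hRa)
  have h2 : ‖(R / a - R / b) • y‖ ≤ ‖x - y‖ := by
    have : R / a - R / b = (R / a) * ((b - a) / b) := by field_simp
    rw [norm_smul, this, norm_mul, norm_div, norm_div, Real.norm_of_nonneg hR.le,
      Real.norm_of_nonneg hapos.le, Real.norm_of_nonneg hbpos.le, Real.norm_eq_abs]
    calc R / a * (|b - a| / b) * ‖y‖ = (R / a) * (‖y‖ / b) * |b - a| := by ring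
      _ ≤ 1 * 1 * |b - a| := by
        gcongr
        · exact (div_le_one hapos).2 hRa
        · exact (div_le_one hbpos).2 hyb
      _ ≤ ‖x - y‖ := by simpa using hab
  rw [hsplit]
  refine (norm_add_le _ _).trans ?_
  have : ((2 : NNReal) : ℝ) = 2 := rfl
  rw [this]
  linarith

end RadialRetraction

/-! ### Bootstrap and Grönwall estimates. -/

/-- A continuous function which cannot reach the level `K` without staying below `η < K` remains
below `η`. -/
lemma forall_le_of_bootstrap {φ : ℝ → ℝ} {a c η K : ℝ} (hφ : ContinuousOn φ (Icc a c)) (hη : η < K)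
    (h : ∀ t ∈ Icc a c, (∀ s ∈ Ico a t, φ s ≤ K) → φ t ≤ η) : ∀ t ∈ Icc a c, φ t ≤ η := by
  refine fun t ht => h t ht fun s hs => ?_
  by_contra! hK
  have hclosed : IsClosed (Icc a c ∩ φ ⁻¹' Ici K) :=
    hφ.preimage_isClosed_of_isClosed isClosed_Icc isClosed_Ici
  have hcomp : IsCompact (Icc a c ∩ φ ⁻¹' Ici K) :=
    isCompact_Icc.of_isClosed_subset hclosed inter_subset_left
  -- At the first time `u` where `φ` reaches `K`, the hypothesis applies and gives `φ u ≤ η < K`.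
  obtain ⟨u, ⟨huI, huK⟩, hmin⟩ :=
    hcomp.exists_isLeast ⟨s, ⟨hs.1, hs.2.le.trans ht.2⟩, hK.le⟩
  have hu := h u huI fun v hv => by
    by_contra! hv'
    exact absurd (hmin ⟨⟨hv.1, hv.2.le.trans huI.2⟩, hv'.le⟩) (not_le.2 hv.2)
  exact absurd (hu.trans_lt hη) (not_lt.2 huK)

/-- Since `K ≥ 1`, the factor `1 / K` on `ε` can be dropped; Lipschitz constants are enlarged to at
least one for this purpose. -/
lemma gronwallBound_le {δ ε K T : ℝ} (hε : 0 ≤ ε) (hK : 1 ≤ K) :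
    gronwallBound δ K ε T ≤ (δ + ε) * Real.exp (K * T) := by
  rw [gronwallBound_of_K_ne_0 (by positivity)]
  have h1 : ε / K ≤ ε := div_le_self hε hK
  have h2 : ε / K * (Real.exp (K * T) - 1) ≤ ε * Real.exp (K * T) := by
    have h3 : 0 ≤ ε / K := by positivity
    nlinarith [Real.exp_pos (K * T)]
  simp only
  linarith

lemma exists_one_le_lipschitzOnWith_closedBall {E : Type*} [NormedAddCommGroup E] [ProperSpace E]
    {G : Type*} [PseudoEMetricSpace G]
    {F : ℝ → E → G} (hF : LocallyLipschitzUniformlyInTime F) (R : ℝ) :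
    ∃ K : NNReal, 1 ≤ K ∧ ∀ t, LipschitzOnWith K (F t) (Metric.closedBall 0 R) := by
  obtain ⟨L, hL⟩ := hF _ (isCompact_closedBall (0 : E) R)
  exact ⟨max 1 L, le_max_left _ _, fun t => (hL t).weaken (le_max_right _ _)⟩

/-! ### Comparison, existence and uniqueness of trajectories. -/

section Solutions

variable {E : Type*} [NormedAddCommGroup E] [NormedSpace ℝ E]

/-- An approximate trajectory stays close to an exact one, as long as the Lipschitz constant is
valid on a neighbourhood of radius one of the ball that contains the exact trajectory. -/
lemma dist_le_of_approx_trajectory {F : ℝ → E → E} {K : NNReal} {R a c δ ε η : ℝ} (hK : 1 ≤ K)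
    (hF : ∀ t, LipschitzOnWith K (F t) (Metric.closedBall 0 (R + 1)))
    {x x' y : ℝ → E} (hxc : ContinuousOn x (Icc a c)) (hyc : ContinuousOn y (Icc a c))
    (hx : ∀ t ∈ Ico a c, HasDerivWithinAt x (x' t) (Ici t) t)
    (hy : ∀ t ∈ Ico a c, HasDerivWithinAt y (F t (y t)) (Ici t) t)
    (hyR : ∀ t ∈ Icc a c, ‖y t‖ ≤ R)
    (hε : 0 ≤ ε) (hxε : ∀ t ∈ Ico a c, ‖x t‖ ≤ R + 1 → dist (x' t) (F t (x t)) ≤ ε)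
    (hδ : dist (x a) (y a) ≤ δ) (hsmall : (δ + ε) * Real.exp (K * (c - a)) ≤ η) (hη : η < 1) :
    ∀ t ∈ Icc a c, dist (x t) (y t) ≤ η := by
  have hδ0 : 0 ≤ δ := dist_nonneg.trans hδ
  -- While the distance is at most 1, `x` stays in the ball of radius `R + 1`, where the Lipschitz
  -- bound holds and Grönwall gives `η < 1`.
  refine forall_le_of_bootstrap (K := 1) (continuous_dist.comp_continuousOn (hxc.prodMk hyc)) hη
    fun t ht hs => ?_
  have hsub : Icc a t ⊆ Icc a c := Icc_subset_Icc_right ht.2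
  have hsub' : Ico a t ⊆ Ico a c := Ico_subset_Ico_right ht.2
  have hxR : ∀ s ∈ Ico a t, ‖x s‖ ≤ R + 1 := fun s hst => by
    have h1 := hs s hst
    have h2 := hyR s ⟨hst.1, hst.2.le.trans ht.2⟩
    have h3 : ‖x s‖ ≤ ‖y s‖ + ‖x s - y s‖ := norm_le_norm_add_norm_sub' _ _
    rw [dist_eq_norm] at h1
    linarith
  have key := dist_le_of_approx_trajectories_ODE_of_mem (v := F)
    (s := fun _ => Metric.closedBall 0 (R + 1)) (K := K) (a := a) (b := t)
    (f := x) (g := y) (f' := x') (g' := fun s => F s (y s)) (εf := ε) (εg := 0) (δ := δ)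
    (fun s _ => hF s) (hxc.mono hsub) (fun s h => hx s (hsub' h))
    (fun s h => hxε s (hsub' h) (hxR s h)) (fun s h => mem_closedBall_zero_iff.2 (hxR s h))
    (hyc.mono hsub) (fun s h => hy s (hsub' h)) (fun s _ => by simp)
    (fun s h => mem_closedBall_zero_iff.2
      ((hyR s ⟨h.1, h.2.le.trans ht.2⟩).trans (by linarith))) hδ t (right_mem_Icc.2 ht.1)
  refine key.trans ((gronwallBound_le (by simpa using hε) (by exact_mod_cast hK)).trans ?_)
  refine le_trans ?_ hsmall
  rw [add_zero]
  gcongr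
  exact ht.2

namespace IsSolution

variable {F : ℝ → E → E} {t₀ : ℝ} {x₀ : E} {b : EReal} {x : ℝ → E}

lemma restart (h : IsSolution F t₀ x₀ b x) {s : ℝ} (hs : t₀ ≤ s) : IsSolution F s (x s) b x where
  initial := rfl
  deriv t ht htb := (h.deriv t (hs.trans ht) htb).mono (Ici_subset_Ici.2 hs)

lemma continuousOn_Icc (h : IsSolution F t₀ x₀ b x) {c : ℝ} (hc : (c : EReal) < b) :
    ContinuousOn x (Icc t₀ c) := fun t ht =>
  ((h.deriv t ht.1 ((EReal.coe_le_coe_iff.2 ht.2).trans_lt hc)).continuousWithinAt).mono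
    Icc_subset_Ici_self

lemma hasDerivWithinAt_Ici (h : IsSolution F t₀ x₀ b x) {t : ℝ} (ht : t₀ ≤ t)
    (htb : (t : EReal) < b) : HasDerivWithinAt x (F t (x t)) (Ici t) t :=
  (h.deriv t ht htb).mono (Ici_subset_Ici.2 ht)

end IsSolution

lemma exists_trajectory_of_lipschitz_of_bounded [CompleteSpace E] {F : ℝ → E → E} {K C : NNReal}
    (hlip : ∀ t, LipschitzWith K (F t)) (hcont : ∀ x, Continuous fun t => F t x) {t₀ c : ℝ}
    (hc : t₀ ≤ c) (hC : ∀ t ∈ Icc t₀ c, ∀ x, ‖F t x‖ ≤ C) (x₀ : E) :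
    ∃ y : ℝ → E, y t₀ = x₀ ∧ ∀ t ∈ Icc t₀ c, HasDerivWithinAt y (F t (y t)) (Icc t₀ c) t := by
  -- A field bounded by `C` moves a point by at most `C * (c - t₀)`, so a ball of that radius allows
  -- the whole interval at once.
  have h : IsPicardLindelof F (⟨t₀, left_mem_Icc.2 hc⟩ : Icc t₀ c) x₀
      (C * (c - t₀).toNNReal) 0 C K :=
    { lipschitzOnWith := fun t _ => (hlip t).lipschitzOnWith
      continuousOn := fun x _ => (hcont x).continuousOn
      norm_le := fun t ht x _ => hC t ht x
      mul_max_le := by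
        have : 0 ≤ c - t₀ := sub_nonneg.2 hc
        simp [this] }
  exact h.exists_eq_forall_mem_Icc_hasDerivWithinAt₀

/-- Bounded trajectories of a locally Lipschitz system exist on arbitrarily long intervals. -/
lemma exists_trajectory_Icc_of_bounded [ProperSpace E] {F : ℝ → E → E}
    (hlip : LocallyLipschitzUniformlyInTime F) (hcont : ∀ x, Continuous fun t => F t x)
    {t₀ c M : ℝ} {x₀ : E} (hc : t₀ ≤ c)
    (hM : ∀ (b : EReal) (x : ℝ → E), IsSolution F t₀ x₀ b x →
      ∀ t : ℝ, t₀ ≤ t → (t : EReal) < b → ‖x t‖ ≤ M) :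
    ∃ y : ℝ → E, y t₀ = x₀ ∧
      ∀ t ∈ Icc t₀ c, HasDerivWithinAt y (F t (y t)) (Icc t₀ c) t := by
  set η := max M ‖x₀‖ with hηdef
  set R := η + 1 with hRdef
  have hη : 0 ≤ η := (norm_nonneg x₀).trans (le_max_right _ _)
  have hR : 0 < R := by positivity
  obtain ⟨K, -, hK⟩ := exists_one_le_lipschitzOnWith_closedBall hlip R
  obtain ⟨C₀, hC₀⟩ := isCompact_Icc.exists_bound_of_continuousOn (s := Icc t₀ c)
    (hcont 0).continuousOn
  obtain ⟨y, hy0, hy⟩ := exists_trajectory_of_lipschitz_of_bounded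
    (F := fun t x => F t (radialRetraction R x)) (K := K * 2) (C := (C₀ + K * R).toNNReal)
    (fun t => by
      rw [← lipschitzOnWith_univ]
      exact (hK t).comp (lipschitzWith_radialRetraction hR).lipschitzOnWith
        fun x _ => radialRetraction_mem hR x)
    (fun x => hcont _) hc
    (fun t ht x => by
      refine le_trans ?_ (Real.le_coe_toNNReal _)
      have h0 : (0 : E) ∈ Metric.closedBall (0 : E) R := Metric.mem_closedBall_self hR.le
      have hx := radialRetraction_mem hR x
      have h1 := (hK t).dist_le_mul _ hx _ h0
      rw [mem_closedBall_zero_iff] at hx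
      rw [dist_zero_right, dist_eq_norm] at h1
      have h2 := norm_le_norm_add_norm_sub' (F t (radialRetraction R x)) (F t 0)
      have h3 : (K : ℝ) * ‖radialRetraction R x‖ ≤ K * R := by gcongr
      linarith [hC₀ t ht])
    x₀
  have hyc : ContinuousOn y (Icc t₀ c) := HasDerivWithinAt.continuousOn hy
  have hbound : ∀ t ∈ Icc t₀ c, ‖y t‖ ≤ η := by
    -- As long as `‖y‖ ≤ R`, the truncation is inactive, so `y` solves the original equation and the
    -- a priori bound applies.
    refine forall_le_of_bootstrap (K := R) hyc.norm (by linarith) fun t ht hs => ?_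
    rcases eq_or_lt_of_le ht.1 with rfl | hlt
    · rw [hy0]; exact le_max_right _ _
    have hsol : IsSolution F t₀ x₀ (t : EReal) y :=
      { initial := hy0
        deriv := fun s h1 h2 => by
          have h2' : s < t := EReal.coe_lt_coe_iff.1 h2
          have hd := hy s ⟨h1, h2'.le.trans ht.2⟩
          rw [radialRetraction_of_norm_le hR (hs s ⟨h1, h2'⟩)] at hd
          refine hd.mono_of_mem_nhdsWithin ?_
          exact mem_nhdsWithin.2 ⟨Iio c, isOpen_Iio, h2'.trans_le ht.2,
            fun u hu => ⟨hu.2, (mem_Iio.1 hu.1).le⟩⟩ }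
    have hle : ∀ s ∈ Ico t₀ t, ‖y s‖ ≤ η := fun s h =>
      (hM _ _ hsol s h.1 (EReal.coe_lt_coe_iff.2 h.2)).trans (le_max_left _ _)
    -- Solutions live on half-open intervals, so the bound reaches the endpoint `t` by continuity.
    have hcl : t ∈ closure (Ico t₀ t) := by
      rw [closure_Ico hlt.ne]; exact right_mem_Icc.2 ht.1
    exact ((hyc.norm t ht).mono fun s h => ⟨h.1, h.2.le.trans ht.2⟩).closure_le hcl
      continuousWithinAt_const hle
  refine ⟨y, hy0, fun t ht => ?_⟩
  have hd := hy t ht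
  rwa [radialRetraction_of_norm_le hR ((hbound t ht).trans (by linarith))] at hd

/-- Both trajectories have compact image, so one Lipschitz constant serves on the union and Grönwall
uniqueness applies. -/
lemma eqOn_Icc_of_trajectory [ProperSpace E] {F : ℝ → E → E}
    (hlip : LocallyLipschitzUniformlyInTime F) {t₀ c : ℝ} {x y : ℝ → E} (h0 : x t₀ = y t₀)
    (hx : ∀ t ∈ Icc t₀ c, HasDerivWithinAt x (F t (x t)) (Icc t₀ c) t)
    (hy : ∀ t ∈ Icc t₀ c, HasDerivWithinAt y (F t (y t)) (Icc t₀ c) t) :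
    EqOn x y (Icc t₀ c) := by
  have hxc : ContinuousOn x (Icc t₀ c) := HasDerivWithinAt.continuousOn hx
  have hyc : ContinuousOn y (Icc t₀ c) := HasDerivWithinAt.continuousOn hy
  obtain ⟨L, hL⟩ := hlip _ ((isCompact_Icc.image_of_continuousOn hxc).union
    (isCompact_Icc.image_of_continuousOn hyc))
  have hmem : ∀ t ∈ Ico t₀ c, Icc t₀ c ∈ 𝓝[Ici t] t := fun t ht =>
    mem_nhdsWithin.2 ⟨Iio c, isOpen_Iio, ht.2,
      fun u hu => ⟨ht.1.trans hu.2, (mem_Iio.1 hu.1).le⟩⟩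
  exact ODE_solution_unique_of_mem_Icc_right (v := F) (s := fun _ => _) (fun t _ => hL t)
    hxc (fun t ht => (hx t ⟨ht.1, ht.2.le⟩).mono_of_mem_nhdsWithin (hmem t ht))
    (fun t ht => Or.inl (mem_image_of_mem _ ⟨ht.1, ht.2.le⟩))
    hyc (fun t ht => (hy t ⟨ht.1, ht.2.le⟩).mono_of_mem_nhdsWithin (hmem t ht))
    (fun t ht => Or.inr (mem_image_of_mem _ ⟨ht.1, ht.2.le⟩)) h0

/-- Trajectories on arbitrarily long intervals can be glued to a solution on `[t₀, ∞)`. -/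
lemma exists_isSolution_top_of_trajectories [ProperSpace E] {F : ℝ → E → E}
    (hlip : LocallyLipschitzUniformlyInTime F) {t₀ : ℝ} {x₀ : E}
    (h : ∀ c, t₀ ≤ c → ∃ y : ℝ → E, y t₀ = x₀ ∧
      ∀ t ∈ Icc t₀ c, HasDerivWithinAt y (F t (y t)) (Icc t₀ c) t) :
    ∃ x : ℝ → E, IsSolution F t₀ x₀ ⊤ x := by
  have h' : ∀ k : ℕ, ∃ y : ℝ → E, y t₀ = x₀ ∧
      ∀ t ∈ Icc t₀ (t₀ + k + 1), HasDerivWithinAt y (F t (y t)) (Icc t₀ (t₀ + k + 1)) t :=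
    fun k => h _ (by have : (0 : ℝ) ≤ k := k.cast_nonneg; linarith)
  choose y hy0 hy using h'
  have hagree : ∀ j k : ℕ, j ≤ k → EqOn (y j) (y k) (Icc t₀ (t₀ + j + 1)) := fun j k hjk => by
    have hsub : Icc t₀ (t₀ + j + 1) ⊆ Icc t₀ (t₀ + k + 1) := by
      refine Icc_subset_Icc_right ?_
      gcongr
    exact eqOn_Icc_of_trajectory hlip ((hy0 j).trans (hy0 k).symm) (hy j)
      fun t ht => (hy k t (hsub ht)).mono hsub
  -- The extra `+ 1` makes this strict, so the interval of the chosen piece contains a right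
  -- neighbourhood of `t`.
  have hfloor : ∀ t, t < t₀ + (⌊t - t₀⌋₊ : ℝ) + 1 := fun t => by
    have := Nat.lt_floor_add_one (t - t₀)
    linarith
  have hglue : ∀ k : ℕ, EqOn (fun t => y ⌊t - t₀⌋₊ t) (y k) (Icc t₀ (t₀ + k + 1)) :=
    fun k t ht => by
      rcases le_total ⌊t - t₀⌋₊ k with hle | hle
      · exact hagree _ _ hle ⟨ht.1, (hfloor t).le⟩
      · exact (hagree _ _ hle ht).symm
  refine ⟨fun t => y ⌊t - t₀⌋₊ t, hy0 _, fun t ht _ => ?_⟩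
  set k := ⌊t - t₀⌋₊ with hk
  have htk : t ∈ Icc t₀ (t₀ + k + 1) := ⟨ht, (hfloor t).le⟩
  have hd := ((hy k t htk).congr (fun s hs => hglue k hs) (hglue k htk))
  refine hd.mono_of_mem_nhdsWithin ?_
  exact mem_nhdsWithin.2 ⟨Iio (t₀ + k + 1), isOpen_Iio, hfloor t,
    fun u hu => ⟨hu.2, (mem_Iio.1 hu.1).le⟩⟩

lemma BoundedUniformlyInInitialTime.isForwardComplete [ProperSpace E] {F : ℝ → E → E}
    (hb : BoundedUniformlyInInitialTime F) (hlip : LocallyLipschitzUniformlyInTime F)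
    (hcont : ∀ x, Continuous fun t => F t x) : IsForwardComplete F := fun t₀ x₀ => by
  obtain ⟨M, -, hM⟩ := hb x₀
  exact exists_isSolution_top_of_trajectories hlip fun c hc =>
    exists_trajectory_Icc_of_bounded hlip hcont hc (hM t₀)

end Solutions

/-! ### Construction of class `K∞` bounds. -/

lemma IsClassKInf.exists_pos_le {γ : ℝ → ℝ} (hγ : IsClassKInf γ) {ε : ℝ} (hε : 0 < ε) :
    ∃ δ, 0 < δ ∧ γ δ ≤ ε := by
  have h := hγ.continuousOn 0 self_mem_Ici
  obtain ⟨δ, hδ, h⟩ := Metric.continuousWithinAt_iff.1 h ε hε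
  refine ⟨δ / 2, by positivity, ?_⟩
  have := h (x := δ / 2) (mem_Ici.2 (by positivity))
    (by rw [Real.dist_eq, sub_zero, abs_of_pos (by positivity)]; linarith)
  rw [hγ.map_zero, Real.dist_eq, sub_zero] at this
  exact (le_abs_self _).trans this.le

/-- A monotone function that is right continuous and zero at zero has a majorant of class `K∞`. -/
lemma exists_isClassKInf_of_monotone {β : ℝ → ℝ} (hmono : Monotone β) (hnonneg : ∀ r, 0 ≤ β r)
    (hzero : ∀ ε > 0, ∃ δ > 0, β δ ≤ ε) :
    ∃ γ : ℝ → ℝ, IsClassKInf γ ∧ ∀ r, 0 ≤ r → β r ≤ γ r := by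
  have hint : ∀ a b, IntervalIntegrable β MeasureTheory.volume a b :=
    fun a b => hmono.intervalIntegrable
  have hint' : ∀ r, 0 ≤ r → IntervalIntegrable (fun u => β (r * u)) MeasureTheory.volume 1 2 :=
    fun r hr => (hmono.comp (monotone_mul_left_of_nonneg hr)).intervalIntegrable
  have hβ0 : β 0 = 0 := by
    refine le_antisymm (le_of_forall_pos_le_add fun ε hε => ?_) (hnonneg 0)
    obtain ⟨δ, hδ, h⟩ := hzero ε hε
    linarith [hmono hδ.le]
  have hle : ∀ r, 0 ≤ r → β r ≤ ∫ u in (1 : ℝ)..2, β (r * u) := fun r hr => by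
    have := intervalIntegral.integral_mono_on (a := 1) (b := 2) (μ := MeasureTheory.volume)
      (f := fun _ => β r) (by norm_num) (by simp) (hint' r hr)
      fun u hu => hmono (by nlinarith [hu.1])
    simpa [show (2 : ℝ) - 1 = 1 by norm_num] using this
  have hge : ∀ r, 0 ≤ r → ∫ u in (1 : ℝ)..2, β (r * u) ≤ β (2 * r) := fun r hr => by
    have := intervalIntegral.integral_mono_on (a := 1) (b := 2) (μ := MeasureTheory.volume)
      (g := fun _ => β (2 * r)) (by norm_num) (hint' r hr) (by simp)
      fun u hu => hmono (by nlinarith [hu.2])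
    simpa [show (2 : ℝ) - 1 = 1 by norm_num] using this
  have hform : ∀ r, 0 < r → ∫ u in (1 : ℝ)..2, β (r * u) =
      r⁻¹ * ((∫ s in (0 : ℝ)..(r * 2), β s) - ∫ s in (0 : ℝ)..r, β s) := fun r hr => by
    rw [intervalIntegral.integral_comp_mul_left _ hr.ne', mul_one,
      intervalIntegral.integral_interval_sub_left (hint _ _) (hint _ _), smul_eq_mul]
  have hprim : Continuous fun r => ∫ s in (0 : ℝ)..r, β s :=
    intervalIntegral.continuous_primitive hint 0
  -- The average of `β` over `[r, 2r]` lies between `β r` and `β (2 * r)` and is continuous; adding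
  -- `r` makes it strictly increasing and unbounded.
  refine ⟨fun r => (∫ u in (1 : ℝ)..2, β (r * u)) + r, ⟨?_, ?_, ?_, ?_⟩, fun r hr => ?_⟩
  · refine ContinuousOn.add (fun r hr => ?_) continuousOn_id
    rcases eq_or_lt_of_le (mem_Ici.1 hr) with rfl | hr
    · rw [Metric.continuousWithinAt_iff]
      intro ε hε
      obtain ⟨δ, hδ, h⟩ := hzero (ε / 2) (by positivity)
      refine ⟨δ / 2, by positivity, fun {r} hr hrd => ?_⟩
      rw [Real.dist_eq, sub_zero, abs_of_nonneg hr] at hrd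
      have h0 := (hnonneg r).trans (hle r hr)
      have h1 := (hge r hr).trans ((hmono (by linarith : 2 * r ≤ δ)).trans h)
      rw [Real.dist_eq]
      simp only [zero_mul, hβ0, intervalIntegral.integral_zero, sub_zero]
      rw [abs_of_nonneg h0]
      linarith
    · have hc : ContinuousAt (fun r => r⁻¹ * ((∫ s in (0 : ℝ)..(r * 2), β s)
          - ∫ s in (0 : ℝ)..r, β s)) r := by
        refine (continuousAt_inv₀ hr.ne').mul (ContinuousAt.sub ?_ hprim.continuousAt)
        exact (hprim.comp (continuous_mul_const 2)).continuousAt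
      refine (hc.congr ?_).continuousWithinAt
      filter_upwards [lt_mem_nhds hr] with s hs
      exact (hform s hs).symm
  · intro r hr s hs hrs
    have := intervalIntegral.integral_mono_on (a := 1) (b := 2) (μ := MeasureTheory.volume)
      (by norm_num) (hint' r hr) (hint' s hs)
      fun u hu => hmono (mul_le_mul_of_nonneg_right hrs.le (by linarith [hu.1]))
    simp only
    linarith
  · simp [hβ0]
  · refine tendsto_atTop_mono' _ ?_ tendsto_id
    filter_upwards [eventually_ge_atTop (0 : ℝ)] with r hr
    have := (hnonneg r).trans (hle r hr)
    simp only [id]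
    linarith
  · have := hle r hr
    simp only
    linarith

/-- A relation between radii and values that is bounded over bounded radii and whose values tend
to zero with the radius is dominated by a function of class `K∞`. -/
lemma exists_isClassKInf_of_bounded {P : ℝ → ℝ → Prop}
    (hbdd : ∀ r, ∃ R, ∀ s v, s ≤ r → P s v → v ≤ R)
    (hzero : ∀ ε > 0, ∃ δ > 0, ∀ s v, s ≤ δ → P s v → v ≤ ε) :
    ∃ γ : ℝ → ℝ, IsClassKInf γ ∧ ∀ s v, 0 ≤ s → P s v → v ≤ γ s := by
  have hBdd : ∀ r, BddAbove (insert 0 {v | ∃ s ≤ r, P s v}) := fun r => by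
    obtain ⟨R, hR⟩ := hbdd r
    exact BddAbove.insert 0 ⟨R, fun v ⟨s, hs, hv⟩ => hR s v hs hv⟩
  -- Inserting 0 keeps the supremum nonnegative and over a nonempty set.
  obtain ⟨γ, hγ, h⟩ := exists_isClassKInf_of_monotone
    (β := fun r => sSup (insert 0 {v | ∃ s ≤ r, P s v}))
    (fun r r' hrr => csSup_le_csSup (hBdd r') (insert_nonempty _ _)
      (insert_subset_insert fun v ⟨s, hs, hv⟩ => ⟨s, hs.trans hrr, hv⟩))
    (fun r => le_csSup (hBdd r) (mem_insert _ _))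
    (fun ε hε => by
      obtain ⟨δ, hδ, h⟩ := hzero ε hε
      refine ⟨δ, hδ, csSup_le (insert_nonempty _ _) ?_⟩
      rintro v (rfl | ⟨s, hs, hv⟩)
      · exact hε.le
      · exact h s v hs hv)
  exact ⟨γ, hγ, fun s v hs hv => (le_csSup (hBdd s) (Or.inr ⟨s, le_rfl, hv⟩)).trans (h s hs)⟩

/-! ### The Euclidean norm on the product. -/

section Product

variable {X Z : Type*} [NormedAddCommGroup X] [NormedAddCommGroup Z]

lemma WithLp.norm_le_norm_fst_add_norm_snd (w : WithLp 2 (X × Z)) : ‖w‖ ≤ ‖w.fst‖ + ‖w.snd‖ := by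
  have h := WithLp.prod_norm_sq_eq_of_L2 w
  refine abs_le_of_sq_le_sq' ?_ (by positivity) |>.2
  nlinarith [norm_nonneg w.fst, norm_nonneg w.snd,
    mul_nonneg (norm_nonneg w.fst) (norm_nonneg w.snd)]

lemma WithLp.norm_fst_le_norm (w : WithLp 2 (X × Z)) : ‖w.fst‖ ≤ ‖w‖ := by
  have h := WithLp.prod_norm_sq_eq_of_L2 w
  refine abs_le_of_sq_le_sq' ?_ (by positivity) |>.2
  nlinarith [norm_nonneg w.snd]

lemma WithLp.norm_snd_le_norm (w : WithLp 2 (X × Z)) : ‖w.snd‖ ≤ ‖w‖ := by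
  have h := WithLp.prod_norm_sq_eq_of_L2 w
  refine abs_le_of_sq_le_sq' ?_ (by positivity) |>.2
  nlinarith [norm_nonneg w.fst]

lemma exists_one_le_dist_le_of_locallyLipschitz [ProperSpace (WithLp 2 (X × Z))]
    {f : ℝ → X → Z → X}
    (hlip : LocallyLipschitzUniformlyInTime fun t (w : WithLp 2 (X × Z)) => f t w.fst w.snd)
    (R : ℝ) : ∃ K : NNReal, 1 ≤ K ∧ ∀ t x x' z z', ‖x‖ + ‖z‖ ≤ R → ‖x'‖ + ‖z'‖ ≤ R →
      dist (f t x z) (f t x' z') ≤ K * (dist x x' + dist z z') := by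
  obtain ⟨K, hK1, hK⟩ := exists_one_le_lipschitzOnWith_closedBall hlip R
  refine ⟨K, hK1, fun t x x' z z' h h' => ?_⟩
  have key := (hK t).dist_le_mul (WithLp.toLp 2 (x, z))
    (mem_closedBall_zero_iff.2 ((WithLp.norm_le_norm_fst_add_norm_snd _).trans h))
    (WithLp.toLp 2 (x', z'))
    (mem_closedBall_zero_iff.2 ((WithLp.norm_le_norm_fst_add_norm_snd _).trans h'))
  refine key.trans (mul_le_mul_of_nonneg_left ?_ K.coe_nonneg)
  rw [dist_eq_norm, dist_eq_norm, dist_eq_norm]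
  exact WithLp.norm_le_norm_fst_add_norm_snd _

end Product

/-! ### The `x`-subsystem under small inputs. -/

section DrivenSubsystem

variable {X Z : Type*} [NormedAddCommGroup X] [NormedSpace ℝ X] [NormedAddCommGroup Z]
  [ProperSpace (WithLp 2 (X × Z))] {f : ℝ → X → Z → X} {γ : ℝ → ℝ}

/-- Over a suitable time `T`, a small input `z` perturbs the trajectories of the undriven system
only slightly, so that the final state is small. -/
lemma exists_time_norm_le_of_small_input
    (hlip : LocallyLipschitzUniformlyInTime fun t (w : WithLp 2 (X × Z)) => f t w.fst w.snd)
    (hγ : IsClassKInf γ)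
    (hstab : ∀ (t₀ : ℝ) (x₀ : X) (b : EReal) (x : ℝ → X),
      IsSolution (fun t x => f t x 0) t₀ x₀ b x →
        ∀ t : ℝ, t₀ ≤ t → (t : EReal) < b → ‖x t‖ ≤ γ ‖x₀‖)
    (hattr : IsUGA (fun t x => f t x 0)) {r σ : ℝ} (hr : 0 < r) (hσ : 0 < σ) :
    ∃ T > 0, ∃ ν > 0, ∀ (s : ℝ) (b : EReal) (x : ℝ → X) (z : ℝ → Z),
      (∀ t : ℝ, s ≤ t → (t : EReal) < b → HasDerivWithinAt x (f t (x t) (z t)) (Ici s) t) →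
      ‖x s‖ ≤ r → (∀ t : ℝ, s ≤ t → (t : EReal) < b → ‖z t‖ ≤ ν) →
      ∀ t : ℝ, s ≤ t → t ≤ s + T → (t : EReal) < b →
        ‖x t‖ ≤ γ r + σ ∧ (t = s + T → ‖x t‖ ≤ σ) := by
  obtain ⟨T, hT, hTσ⟩ := hattr.2 r (σ / 2) hr (by positivity)
  -- One unit beyond `γ r` is the bootstrap margin for `x`, the other leaves room for `‖z‖ ≤ 1`.
  obtain ⟨K, hK1, hK⟩ := exists_one_le_dist_le_of_locallyLipschitz hlip (γ r + 2)
  have hKpos : (0 : ℝ) < K := by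
    have : (1 : ℝ) ≤ K := by exact_mod_cast hK1
    linarith
  set η := min (σ / 2) (1 / 2) with hη
  have hηpos : 0 < η := by positivity
  -- An input of size `ν` perturbs the field by at most `K * ν`, which Grönwall amplifies by at most
  -- `exp (K * T)`.
  refine ⟨T, hT, min 1 (η / (K * Real.exp (K * T))), by positivity,
    fun s b x z hx hxr hz t hst htT htb => ?_⟩
  obtain ⟨y, hy⟩ := hattr.1 s (x s)
  have hlt : ∀ u : ℝ, u ≤ t → (u : EReal) < b := fun u hu =>
    (EReal.coe_le_coe_iff.2 hu).trans_lt htb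
  have hyr : ∀ u, s ≤ u → ‖y u‖ ≤ γ r := fun u hu =>
    (hstab s (x s) ⊤ y hy u hu (EReal.coe_lt_top u)).trans
      (hγ.strictMonoOn.monotoneOn (norm_nonneg _) hr.le hxr)
  have hxy : dist (x t) (y t) ≤ η := by
    refine dist_le_of_approx_trajectory (F := fun t x => f t x 0) (K := K) (R := γ r) (a := s)
      (c := t) (δ := 0) (ε := K * min 1 (η / (K * Real.exp (K * T))))
      (x' := fun t => f t (x t) (z t)) hK1 (fun u => ?_) ?_
      (hy.continuousOn_Icc (EReal.coe_lt_top t))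
      (fun u hu => (hx u hu.1 (hlt u hu.2.le)).mono (Ici_subset_Ici.2 hu.1))
      (fun u hu => hy.hasDerivWithinAt_Ici hu.1 (EReal.coe_lt_top u)) (fun u hu => hyr u hu.1)
      (by positivity) (fun u hu hxu => ?_) (by rw [hy.initial, dist_self]) ?_ ?_ t
      (right_mem_Icc.2 hst)
    · refine LipschitzOnWith.of_dist_le_mul fun p hp q hq => ?_
      rw [mem_closedBall_zero_iff] at hp hq
      simpa using hK u p q 0 0 (by rw [norm_zero]; linarith) (by rw [norm_zero]; linarith)
    · exact fun u hu => ((hx u hu.1 (hlt u hu.2)).continuousWithinAt).mono Icc_subset_Ici_self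
    · have hzu := hz u hu.1 (hlt u hu.2.le)
      have := hK u (x u) (x u) (z u) 0 (by linarith [hzu.trans (min_le_left _ _)])
        (by rw [norm_zero]; linarith)
      rw [dist_self, zero_add, dist_zero_right] at this
      exact this.trans (mul_le_mul_of_nonneg_left hzu hKpos.le)
    · calc (0 + K * min 1 (η / (K * Real.exp (K * T)))) * Real.exp (K * (t - s))
          ≤ (K * (η / (K * Real.exp (K * T)))) * Real.exp (K * T) := by
            rw [zero_add]
            gcongr
            · exact min_le_right _ _
            · linarith
        _ = η := by field_simp
    · exact (min_le_right _ _).trans_lt (by norm_num)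
  have hnorm : ‖x t‖ ≤ ‖y t‖ + η := by
    have := norm_le_norm_add_norm_sub' (x t) (y t)
    rw [dist_eq_norm] at hxy
    linarith
  have hησ : η ≤ σ / 2 := min_le_left _ _
  refine ⟨by linarith [hyr t hst], fun ht => ?_⟩
  have := hTσ s (x s) ⊤ y hy hxr t ht.ge (EReal.coe_lt_top t)
  linarith

lemma exists_forall_norm_le_of_small_input
    (hlip : LocallyLipschitzUniformlyInTime fun t (w : WithLp 2 (X × Z)) => f t w.fst w.snd)
    (hγ : IsClassKInf γ)
    (hstab : ∀ (t₀ : ℝ) (x₀ : X) (b : EReal) (x : ℝ → X),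
      IsSolution (fun t x => f t x 0) t₀ x₀ b x →
        ∀ t : ℝ, t₀ ≤ t → (t : EReal) < b → ‖x t‖ ≤ γ ‖x₀‖)
    (hattr : IsUGA (fun t x => f t x 0)) {r σ : ℝ} (hr : 0 < r) (hσ : 0 < σ) :
    ∃ ν > 0, ∀ (s : ℝ) (b : EReal) (x : ℝ → X) (z : ℝ → Z),
      (∀ t : ℝ, s ≤ t → (t : EReal) < b → HasDerivWithinAt x (f t (x t) (z t)) (Ici s) t) →
      ‖x s‖ ≤ r → (∀ t : ℝ, s ≤ t → (t : EReal) < b → ‖z t‖ ≤ ν) →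
      ∀ t : ℝ, s ≤ t → (t : EReal) < b → ‖x t‖ ≤ γ r + σ := by
  -- With `min σ r`, the state at the end of each window is again in the ball of radius `r`, so
  -- windows can be chained.
  obtain ⟨T, hT, ν, hν, h⟩ := exists_time_norm_le_of_small_input hlip hγ hstab hattr hr
    (lt_min hσ hr)
  refine ⟨ν, hν, fun s b x z hx hxr hz t hst htb => ?_⟩
  have key : ∀ k : ℕ, ∀ s, (∀ t : ℝ, s ≤ t → (t : EReal) < b →
      HasDerivWithinAt x (f t (x t) (z t)) (Ici s) t) → ‖x s‖ ≤ r →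
      (∀ t : ℝ, s ≤ t → (t : EReal) < b → ‖z t‖ ≤ ν) → s ≤ t → t ≤ s + (k + 1) * T →
      ‖x t‖ ≤ γ r + σ := by
    intro k
    induction k with
    | zero =>
      intro s hx hxr hz hst ht
      have := (h s b x z hx hxr hz t hst (by simpa using ht) htb).1
      linarith [min_le_left σ r]
    | succ k ih =>
      intro s hx hxr hz hst ht
      rcases le_total t (s + T) with hle | hle
      · have := (h s b x z hx hxr hz t hst hle htb).1
        linarith [min_le_left σ r]
      · have hsT : s ≤ s + T := by linarith
        refine ih (s + T) (fun u hu hub => (hx u (hsT.trans hu) hub).mono (Ici_subset_Ici.2 hsT))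
          ?_ (fun u hu hub => hz u (hsT.trans hu) hub) hle ?_
        · exact ((h s b x z hx hxr hz (s + T) hsT le_rfl
            ((EReal.coe_le_coe_iff.2 hle).trans_lt htb)).2 rfl).trans (min_le_right _ _)
        · push_cast at ht
          linarith
  obtain ⟨k, hk⟩ := exists_nat_ge ((t - s) / T)
  refine key k s hx hxr hz hst ?_
  rw [div_le_iff₀ hT] at hk
  linarith

end DrivenSubsystem

/-! ### Uniform bounds and local stability for the cascade. -/

section Cascade

variable {n m : ℕ}
  {f : ℝ → EuclideanSpace ℝ (Fin n) → EuclideanSpace ℝ (Fin m) → EuclideanSpace ℝ (Fin n)}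
  {g : ℝ → EuclideanSpace ℝ (Fin m) → EuclideanSpace ℝ (Fin m)}

instance instProperSpaceWithLpProd {X Z : Type*} [NormedAddCommGroup X] [NormedSpace ℝ X]
    [NormedAddCommGroup Z] [NormedSpace ℝ Z] [FiniteDimensional ℝ X] [FiniteDimensional ℝ Z] :
    ProperSpace (WithLp 2 (X × Z)) :=
  FiniteDimensional.proper ℝ _

lemma continuous_cascade (hf : ∀ x z, Continuous (fun t => f t x z))
    (hg : ∀ z, Continuous (fun t => g t z))
    (w : WithLp 2 (EuclideanSpace ℝ (Fin n) × EuclideanSpace ℝ (Fin m))) :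
    Continuous fun t => cascade f g t w :=
  (WithLp.prod_continuous_toLp 2 _ _).comp ((hf _ _).prodMk (hg _))

lemma locallyLipschitzUniformlyInTime_cascade
    (hf : LocallyLipschitzUniformlyInTime
      (fun (t : ℝ) (w : WithLp 2 (EuclideanSpace ℝ (Fin n) × EuclideanSpace ℝ (Fin m))) =>
        f t w.fst w.snd))
    (hg : LocallyLipschitzUniformlyInTime g) :
    LocallyLipschitzUniformlyInTime (cascade f g) := fun K hK => by
  obtain ⟨L, hL⟩ := hf K hK
  obtain ⟨L', hL'⟩ := hg _ (hK.image (WithLp.sndL 2 ℝ _ _).continuous)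
  refine ⟨L + L', fun t => LipschitzOnWith.of_dist_le_mul fun v hv w hw => ?_⟩
  have h1 := (hL t).dist_le_mul v hv w hw
  have h2 := (hL' t).dist_le_mul v.snd (mem_image_of_mem _ hv) w.snd (mem_image_of_mem _ hw)
  have h3 : dist v.snd w.snd ≤ dist v w := by
    rw [dist_eq_norm, dist_eq_norm]
    exact WithLp.norm_snd_le_norm (v - w)
  have h4 : dist (cascade f g t v) (cascade f g t w)
      ≤ dist (f t v.fst v.snd) (f t w.fst w.snd) + dist (g t v.snd) (g t w.snd) := by
    rw [dist_eq_norm, dist_eq_norm, dist_eq_norm]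
    exact WithLp.norm_le_norm_fst_add_norm_snd _
  have h5 : (L' : ℝ) * dist v.snd w.snd ≤ L' * dist v w := by gcongr
  push_cast
  linarith

variable {t₀ : ℝ} {w₀ : WithLp 2 (EuclideanSpace ℝ (Fin n) × EuclideanSpace ℝ (Fin m))} {b : EReal}
  {w : ℝ → WithLp 2 (EuclideanSpace ℝ (Fin n) × EuclideanSpace ℝ (Fin m))}

lemma IsSolution.hasDerivWithinAt_fst (h : IsSolution (cascade f g) t₀ w₀ b w) (t : ℝ)
    (ht : t₀ ≤ t) (htb : (t : EReal) < b) :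
    HasDerivWithinAt (fun t => (w t).fst) (f t (w t).fst (w t).snd) (Ici t₀) t :=
  (WithLp.fstL 2 ℝ (EuclideanSpace ℝ (Fin n)) (EuclideanSpace ℝ (Fin m))).hasFDerivAt
    |>.comp_hasDerivWithinAt t (h.deriv t ht htb)

lemma IsSolution.snd (h : IsSolution (cascade f g) t₀ w₀ b w) :
    IsSolution g t₀ w₀.snd b (fun t => (w t).snd) where
  initial := by rw [h.initial]
  deriv t ht htb :=
    (WithLp.sndL 2 ℝ (EuclideanSpace ℝ (Fin n)) (EuclideanSpace ℝ (Fin m))).hasFDerivAt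
      |>.comp_hasDerivWithinAt t (h.deriv t ht htb)

/-- The horizon for Grönwall is the time that `z` needs to become small. It and the Lipschitz
constant do not depend on `t₀`, hence neither does `δ`. -/
lemma exists_nhds_bound_cascade
    (hf_cont : ∀ x z, Continuous (fun t => f t x z)) (hg_cont : ∀ z, Continuous (fun t => g t z))
    (hf_lip : LocallyLipschitzUniformlyInTime
      (fun (t : ℝ) (w : WithLp 2 (EuclideanSpace ℝ (Fin n) × EuclideanSpace ℝ (Fin m))) =>
        f t w.fst w.snd))
    (hg_lip : LocallyLipschitzUniformlyInTime g)
    (hbdd : BoundedUniformlyInInitialTime (cascade f g))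
    (hz : IsUGAS g) (hx : IsUGAS (fun t x => f t x 0))
    (v₀ : WithLp 2 (EuclideanSpace ℝ (Fin n) × EuclideanSpace ℝ (Fin m))) :
    ∃ δ > 0, ∃ R, ∀ w₀, dist w₀ v₀ ≤ δ → ∀ (t₀ : ℝ) (b : EReal) w,
      IsSolution (cascade f g) t₀ w₀ b w →
        ∀ t : ℝ, t₀ ≤ t → (t : EReal) < b → ‖w t‖ ≤ R := by
  have hlip := locallyLipschitzUniformlyInTime_cascade hf_lip hg_lip
  have hcomplete := hbdd.isForwardComplete hlip (continuous_cascade hf_cont hg_cont)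
  obtain ⟨M, hM, hMbd⟩ := hbdd v₀
  obtain ⟨γ, hγ, hstab⟩ := hx.1.2
  obtain ⟨ν, hν, hinv⟩ := exists_forall_norm_le_of_small_input hf_lip hγ hstab hx.2
    (r := M + 1) (σ := 1) (by positivity) one_pos
  obtain ⟨T, hT, hTν⟩ := hz.2.2 (‖v₀.snd‖ + 1) ν (by positivity) hν
  obtain ⟨K, hK1, hK⟩ := exists_one_le_lipschitzOnWith_closedBall hlip (M + 1)
  -- This radius cancels the Grönwall factor up to time `T`, leaving a distance of at most 1/2 from
  -- the trajectory of `v₀`.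
  refine ⟨1 / 2 * Real.exp (-(K * T)), by positivity, max (M + 1) (γ (M + 1) + 1 + ν),
    fun w₀ hw₀ t₀ b w hw t ht htb => ?_⟩
  obtain ⟨v, hv⟩ := hcomplete t₀ v₀
  have hshort : ∀ u : ℝ, t₀ ≤ u → u ≤ t₀ + T → (u : EReal) < b → ‖w u‖ ≤ M + 1 := by
    intro u hu huT hub
    have hvM : ∀ s, t₀ ≤ s → ‖v s‖ ≤ M := fun s hs => hMbd t₀ ⊤ v hv s hs (EReal.coe_lt_top s)
    have hdist : dist (w u) (v u) ≤ 1 / 2 := by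
      refine dist_le_of_approx_trajectory (F := cascade f g) (K := K) (R := M) (a := t₀) (c := u)
        (ε := 0) (x' := fun s => cascade f g s (w s)) hK1 hK (hw.continuousOn_Icc hub)
        (hv.continuousOn_Icc (EReal.coe_lt_top u))
        (fun s hs => hw.hasDerivWithinAt_Ici hs.1 ((EReal.coe_lt_coe_iff.2 hs.2).trans hub))
        (fun s hs => hv.hasDerivWithinAt_Ici hs.1 (EReal.coe_lt_top s))
        (fun s hs => hvM s hs.1) le_rfl (fun s _ _ => (dist_self _).le)
        (δ := 1 / 2 * Real.exp (-(K * T))) (by rwa [hw.initial, hv.initial]) ?_ (by norm_num) u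
        (right_mem_Icc.2 hu)
      rw [add_zero, mul_assoc, ← Real.exp_add]
      refine mul_le_of_le_one_right (by norm_num) (Real.exp_le_one_iff.2 ?_)
      have : (K : ℝ) * (u - t₀) ≤ K * T := by
        gcongr
        linarith
      linarith
    have := norm_le_norm_add_norm_sub' (w u) (v u)
    rw [dist_eq_norm] at hdist
    linarith [hvM u hu]
  rcases le_total t (t₀ + T) with hle | hle
  · exact (hshort t ht hle htb).trans (le_max_left _ _)
  · have htT : t₀ ≤ t₀ + T := by linarith
    have hz₀ : ‖w₀.snd‖ ≤ ‖v₀.snd‖ + 1 := by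
      have h1 := norm_le_norm_add_norm_sub' w₀.snd v₀.snd
      have h2 : ‖w₀.snd - v₀.snd‖ ≤ ‖w₀ - v₀‖ := WithLp.norm_snd_le_norm (w₀ - v₀)
      have h3 : Real.exp (-(K * T)) ≤ 1 := Real.exp_le_one_iff.2 (neg_nonpos.2 (by positivity))
      rw [dist_eq_norm] at hw₀
      linarith
    have hzν : ∀ u : ℝ, t₀ + T ≤ u → (u : EReal) < b → ‖(w u).snd‖ ≤ ν :=
      hTν t₀ _ b _ hw.snd hz₀
    have hxs := hinv (t₀ + T) b (fun u => (w u).fst) (fun u => (w u).snd)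
      (hw.restart htT).hasDerivWithinAt_fst ((WithLp.norm_fst_le_norm _).trans
        (hshort _ htT le_rfl ((EReal.coe_le_coe_iff.2 hle).trans_lt htb))) hzν t hle htb
    refine le_trans ?_ (le_max_right _ _)
    exact (WithLp.norm_le_norm_fst_add_norm_snd _).trans (add_le_add hxs (hzν t hle htb))

lemma exists_bound_cascade_of_norm_le
    (hf_cont : ∀ x z, Continuous (fun t => f t x z)) (hg_cont : ∀ z, Continuous (fun t => g t z))
    (hf_lip : LocallyLipschitzUniformlyInTime
      (fun (t : ℝ) (w : WithLp 2 (EuclideanSpace ℝ (Fin n) × EuclideanSpace ℝ (Fin m))) =>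
        f t w.fst w.snd))
    (hg_lip : LocallyLipschitzUniformlyInTime g)
    (hbdd : BoundedUniformlyInInitialTime (cascade f g))
    (hz : IsUGAS g) (hx : IsUGAS (fun t x => f t x 0)) (r : ℝ) :
    ∃ R, ∀ w₀, ‖w₀‖ ≤ r → ∀ (t₀ : ℝ) (b : EReal) w, IsSolution (cascade f g) t₀ w₀ b w →
      ∀ t : ℝ, t₀ ≤ t → (t : EReal) < b → ‖w t‖ ≤ R := by
  have key := (isCompact_closedBall
    (0 : WithLp 2 (EuclideanSpace ℝ (Fin n) × EuclideanSpace ℝ (Fin m))) r).induction_on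
    (p := fun S => ∃ R, ∀ w₀ ∈ S, ∀ (t₀ : ℝ) (b : EReal) w, IsSolution (cascade f g) t₀ w₀ b w →
      ∀ t : ℝ, t₀ ≤ t → (t : EReal) < b → ‖w t‖ ≤ R)
    ⟨0, fun w₀ h => h.elim⟩
    (fun S S' hS ⟨R, hR⟩ => ⟨R, fun w₀ h => hR w₀ (hS h)⟩)
    (fun S S' ⟨R, hR⟩ ⟨R', hR'⟩ => ⟨max R R', fun w₀ h t₀ b w hw t ht htb => h.elim
      (fun h => (hR w₀ h t₀ b w hw t ht htb).trans (le_max_left _ _))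
      (fun h => (hR' w₀ h t₀ b w hw t ht htb).trans (le_max_right _ _))⟩)
    (fun v₀ _ => by
      obtain ⟨δ, hδ, R, hR⟩ :=
        exists_nhds_bound_cascade hf_cont hg_cont hf_lip hg_lip hbdd hz hx v₀
      exact ⟨Metric.closedBall v₀ δ, mem_nhdsWithin_of_mem_nhds (Metric.closedBall_mem_nhds _ hδ),
        R, fun w₀ h => hR w₀ h⟩)
  obtain ⟨R, hR⟩ := key
  exact ⟨R, fun w₀ h => hR w₀ (mem_closedBall_zero_iff.2 h)⟩

/-- Uniform local stability of the origin of the cascade. -/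
lemma exists_pos_bound_cascade
    (hf_lip : LocallyLipschitzUniformlyInTime
      (fun (t : ℝ) (w : WithLp 2 (EuclideanSpace ℝ (Fin n) × EuclideanSpace ℝ (Fin m))) =>
        f t w.fst w.snd))
    (hz : IsUGAS g) (hx : IsUGAS (fun t x => f t x 0)) {ε : ℝ} (hε : 0 < ε) :
    ∃ δ > 0, ∀ w₀, ‖w₀‖ ≤ δ → ∀ (t₀ : ℝ) (b : EReal) w, IsSolution (cascade f g) t₀ w₀ b w →
      ∀ t : ℝ, t₀ ≤ t → (t : EReal) < b → ‖w t‖ ≤ ε := by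
  obtain ⟨γ, hγ, hstab⟩ := hx.1.2
  obtain ⟨γz, hγz, hstabz⟩ := hz.1.2
  obtain ⟨r, hr, hγr⟩ := hγ.exists_pos_le (ε := ε / 4) (by positivity)
  obtain ⟨ν, hν, hinv⟩ := exists_forall_norm_le_of_small_input hf_lip hγ hstab hx.2
    hr (σ := ε / 4) (by positivity)
  obtain ⟨δ, hδ, hγδ⟩ := hγz.exists_pos_le (ε := min ν (ε / 4)) (by positivity)
  refine ⟨min r δ, by positivity, fun w₀ hw₀ t₀ b w hw t ht htb => ?_⟩
  have hzν : ∀ u : ℝ, t₀ ≤ u → (u : EReal) < b → ‖(w u).snd‖ ≤ min ν (ε / 4) := fun u hu hub =>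
    (hstabz t₀ _ b _ hw.snd u hu hub).trans <| (hγz.strictMonoOn.monotoneOn (norm_nonneg _) hδ.le
      ((WithLp.norm_snd_le_norm _).trans (hw₀.trans (min_le_right _ _)))).trans hγδ
  have hxt := hinv t₀ b (fun u => (w u).fst) (fun u => (w u).snd) hw.hasDerivWithinAt_fst
    (by
      simp only [hw.initial]
      exact (WithLp.norm_fst_le_norm _).trans (hw₀.trans (min_le_left _ _)))
    (fun u hu hub => (hzν u hu hub).trans (min_le_left _ _)) t ht htb
  have h1 := WithLp.norm_le_norm_fst_add_norm_snd (w t)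
  have h2 := (hzν t ht htb).trans (min_le_right _ _)
  linarith

end Cascade

theorem mainTheorem6 (n m : ℕ)
    (f : ℝ → EuclideanSpace ℝ (Fin n) → EuclideanSpace ℝ (Fin m) → EuclideanSpace ℝ (Fin n))
    (g : ℝ → EuclideanSpace ℝ (Fin m) → EuclideanSpace ℝ (Fin m))
    (hf_cont : ∀ x z, Continuous (fun t => f t x z))
    (hg_cont : ∀ z, Continuous (fun t => g t z))
    (hf_lip : LocallyLipschitzUniformlyInTime
      (fun (t : ℝ) (w : WithLp 2 (EuclideanSpace ℝ (Fin n) × EuclideanSpace ℝ (Fin m))) =>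
        f t w.fst w.snd))
    (hg_lip : LocallyLipschitzUniformlyInTime g)
    (hbdd : BoundedUniformlyInInitialTime (cascade f g))
    (hz : IsUGAS g)
    (hx : IsUGAS (fun t x => f t x 0)) :
    IsUGAS (cascade f g) := by
  have hcomplete : IsForwardComplete (cascade f g) :=
    hbdd.isForwardComplete (locallyLipschitzUniformlyInTime_cascade hf_lip hg_lip)
      (continuous_cascade hf_cont hg_cont)
  have hbound := exists_bound_cascade_of_norm_le hf_cont hg_cont hf_lip hg_lip hbdd hz hx
  refine ⟨⟨hcomplete, ?_⟩, hcomplete, fun r σ hr hσ => ?_⟩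
  · obtain ⟨γ, hγ, h⟩ := exists_isClassKInf_of_bounded
      (P := fun s v => ∃ (t₀ : ℝ) (w₀ : _) (b : EReal) (w : _) (t : ℝ),
        IsSolution (cascade f g) t₀ w₀ b w ∧ t₀ ≤ t ∧ (t : EReal) < b ∧ ‖w₀‖ = s ∧ ‖w t‖ = v)
      (fun r => by
        obtain ⟨R, hR⟩ := hbound r
        refine ⟨R, ?_⟩
        rintro _ _ hs ⟨t₀, w₀, b, w, t, hw, ht, htb, rfl, rfl⟩
        exact hR w₀ hs t₀ b w hw t ht htb)
      (fun ε hε => by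
        obtain ⟨δ, hδ, h⟩ := exists_pos_bound_cascade hf_lip hz hx hε
        refine ⟨δ, hδ, ?_⟩
        rintro _ _ hs ⟨t₀, w₀, b, w, t, hw, ht, htb, rfl, rfl⟩
        exact h w₀ hs t₀ b w hw t ht htb)
    exact ⟨γ, hγ, fun t₀ w₀ b w hw t ht htb =>
      h _ _ (norm_nonneg _) ⟨t₀, w₀, b, w, t, hw, ht, htb, rfl, rfl⟩⟩
  · obtain ⟨R, hR⟩ := hbound r
    obtain ⟨δ, hδ, hδσ⟩ := exists_pos_bound_cascade hf_lip hz hx hσ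
    obtain ⟨γ, hγ, hstab⟩ := hx.1.2
    -- Here `max R 1` only ensures a positive radius; `x` and `z` each get half of `δ`.
    obtain ⟨T₂, hT₂, ν, hν, hstep⟩ := exists_time_norm_le_of_small_input hf_lip hγ hstab hx.2
      (r := max R 1) (σ := δ / 2) (by positivity) (by positivity)
    obtain ⟨T₁, hT₁, hzT⟩ := hz.2.2 r (min ν (δ / 2)) hr (by positivity)
    refine ⟨T₁ + T₂, by positivity, fun t₀ w₀ b w hw hw₀ t ht htb => ?_⟩
    have hlt : ∀ u : ℝ, u ≤ t → (u : EReal) < b := fun u hu =>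
      (EReal.coe_le_coe_iff.2 hu).trans_lt htb
    have hs : t₀ ≤ t₀ + T₁ := by linarith
    have hs' : t₀ + T₁ ≤ t₀ + T₁ + T₂ := by linarith
    have hst : t₀ + T₁ + T₂ ≤ t := by linarith
    have hzν : ∀ u : ℝ, t₀ + T₁ ≤ u → (u : EReal) < b → ‖(w u).snd‖ ≤ min ν (δ / 2) :=
      hzT t₀ _ b _ hw.snd ((WithLp.norm_snd_le_norm _).trans hw₀)
    have hxs := (hstep (t₀ + T₁) b (fun u => (w u).fst) (fun u => (w u).snd)
      (hw.restart hs).hasDerivWithinAt_fst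
      ((WithLp.norm_fst_le_norm _).trans ((hR w₀ hw₀ t₀ b w hw _ hs
        (hlt _ (hs'.trans hst))).trans (le_max_left _ _)))
      (fun u hu hub => (hzν u hu hub).trans (min_le_left _ _)) _ hs' le_rfl (hlt _ hst)).2 rfl
    have hzs := (hzν _ hs' (hlt _ hst)).trans (min_le_right _ _)
    refine hδσ (w (t₀ + T₁ + T₂)) ?_ _ b w (hw.restart (hs.trans hs')) t hst htb
    refine (WithLp.norm_le_norm_fst_add_norm_snd _).trans ?_
    linarith
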